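/- Let $G=(V,E)$ be a finite simple undirected graph with $V\neq\emptyset$. The clique hypergraph $\mathcal C(G)$ consists of the inclusion-wise maximal cliques of $G$. The dual $\mathcal H^d$ of a hypergraph $\mathcal H$ on $V$ consists of the inclusion-wise minimal sets $T\subseteq V$ that intersect every hyperedge of $\mathcal H$. A hypergraph on $V$ is conformal if every set $S\subseteq V$ such that any two distinct vertices of $S$ belong to a common hyperedge is contained in a hyperedge. The graph $G$ is clique dually conformal (CDC) if $\mathcal C(G)^d$ is conformal, and triangle-free if it has no three pairwise adjacent vertices. Theorem. There exists an algorithm running in time $\mathcal O(|V|(|V|+|E|)^2)$ that determines whether a given graph $G=(V,E)$ is a triangle-free CDC graph. Here the graph is given by adjacency lists, and running time is the number of steps on a random access machine with words of $O(\log |V|)$ bits (word RAM) in which every arithmetic operation, comparison and memory access takes one step. -/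

import Mathlib

/-! ### Hypergraphs and clique dually conformal graphs -/

namespace Hypergraph

/-- `T` is a transversal of the hypergraph with hyperedge set `H`: it meets every hyperedge. -/
def IsTransversal {V : Type*} (H : Set (Set V)) (T : Set V) : Prop :=
  ∀ e ∈ H, (e ∩ T).Nonempty

/-- The dual hypergraph: its hyperedges are the inclusion-wise minimal transversals. -/
def dual {V : Type*} (H : Set (Set V)) : Set (Set V) :=
  {T | Minimal (IsTransversal H) T}

/-- A hypergraph is conformal if every set of vertices, any two of which belong to a common
hyperedge, is contained in a hyperedge. -/
def IsConformal {V : Type*} (H : Set (Set V)) : Prop :=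
  ∀ S : Set V, (∀ u ∈ S, ∀ v ∈ S, u ≠ v → ∃ e ∈ H, u ∈ e ∧ v ∈ e) → ∃ e ∈ H, S ⊆ e

end Hypergraph

namespace SimpleGraph

/-- The clique hypergraph: its hyperedges are the inclusion-wise maximal cliques. -/
def cliqueHypergraph {V : Type*} (G : SimpleGraph V) : Set (Set V) :=
  {K | Maximal (fun S : Set V => G.IsClique S) K}

/-- `G` is clique dually conformal: the dual of its clique hypergraph is conformal. -/
def IsCDC {V : Type*} (G : SimpleGraph V) : Prop :=
  Hypergraph.IsConformal (Hypergraph.dual G.cliqueHypergraph)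

end SimpleGraph

/-! ### Word RAM: structured programs, with a step count -/

namespace WordRAM

/-- A state of the machine: the contents of the registers and of the random access memory. -/
structure State where
  reg : ℕ → ℕ
  mem : ℕ → ℕ

/-- The state after writing `a` into register `x`. -/
def State.setReg (s : State) (x a : ℕ) : State :=
  { s with reg := Function.update s.reg x a }

/-- The state after writing `a` into memory cell `i`. -/
def State.setMem (s : State) (i a : ℕ) : State :=
  { s with mem := Function.update s.mem i a }

/-- Programs. The arguments `x y z` are names of registers (each program mentions only finitely
many), `k` is a constant. Memory is addressed indirectly, through the content of a register. -/
inductive Program where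
  /-- do nothing -/
  | skip : Program
  /-- `x := k` -/
  | const (x k : ℕ) : Program
  /-- `x := y + z` -/
  | add (x y z : ℕ) : Program
  /-- `x := max (y - z) 0` -/
  | sub (x y z : ℕ) : Program
  /-- `x := y * z` -/
  | mul (x y z : ℕ) : Program
  /-- `x := mem[y]` -/
  | load (x y : ℕ) : Program
  /-- `mem[x] := y` -/
  | store (x y : ℕ) : Program
  /-- `P` followed by `Q` -/
  | seq (P Q : Program) : Program
  /-- `if x < y then P else Q` -/
  | ifLt (x y : ℕ) (P Q : Program) : Program
  /-- `while x < y do P` -/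
  | whileLt (x y : ℕ) (P : Program) : Program

/-- `Exec w P s t s'`: on the machine with `w`-bit words, the program `P` started in the state `s`
halts in the state `s'` after exactly `t` steps. Each elementary instruction and each evaluation of
a test is one step. An instruction whose result does not fit into a word has no execution. -/
inductive Exec (w : ℕ) : Program → State → ℕ → State → Prop where
  | skip (s : State) : Exec w .skip s 1 s
  | const (s : State) (x k : ℕ) (h : k < 2 ^ w) :
      Exec w (.const x k) s 1 (s.setReg x k)
  | add (s : State) (x y z : ℕ) (h : s.reg y + s.reg z < 2 ^ w) :
      Exec w (.add x y z) s 1 (s.setReg x (s.reg y + s.reg z))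
  | sub (s : State) (x y z : ℕ) :
      Exec w (.sub x y z) s 1 (s.setReg x (s.reg y - s.reg z))
  | mul (s : State) (x y z : ℕ) (h : s.reg y * s.reg z < 2 ^ w) :
      Exec w (.mul x y z) s 1 (s.setReg x (s.reg y * s.reg z))
  | load (s : State) (x y : ℕ) :
      Exec w (.load x y) s 1 (s.setReg x (s.mem (s.reg y)))
  | store (s : State) (x y : ℕ) :
      Exec w (.store x y) s 1 (s.setMem (s.reg x) (s.reg y))
  | seq {P Q : Program} {s s' s'' : State} {t t' : ℕ}
      (hP : Exec w P s t s') (hQ : Exec w Q s' t' s'') :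
      Exec w (.seq P Q) s (t + t') s''
  | ifTrue {x y : ℕ} {P Q : Program} {s s' : State} {t : ℕ}
      (h : s.reg x < s.reg y) (hP : Exec w P s t s') :
      Exec w (.ifLt x y P Q) s (1 + t) s'
  | ifFalse {x y : ℕ} {P Q : Program} {s s' : State} {t : ℕ}
      (h : ¬ s.reg x < s.reg y) (hQ : Exec w Q s t s') :
      Exec w (.ifLt x y P Q) s (1 + t) s'
  | whileTrue {x y : ℕ} {P : Program} {s s' s'' : State} {t t' : ℕ}
      (h : s.reg x < s.reg y) (hP : Exec w P s t s') (hW : Exec w (.whileLt x y P) s' t' s'') :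
      Exec w (.whileLt x y P) s (1 + t + t') s''
  | whileFalse {x y : ℕ} {P : Program} {s : State}
      (h : ¬ s.reg x < s.reg y) :
      Exec w (.whileLt x y P) s 1 s

/-- The initial state on a given input: the input occupies the first memory cells; the other cells
and all registers hold `0`. -/
def init (input : List ℕ) : State where
  reg := fun _ => 0
  mem := fun i => input.getD i 0

/-- On the `w`-bit machine, the program `P` halts on the input after at most `b` steps, with `1` in
register `0` if `answer` is true and with `0` there if it is false. -/
def DecidesWithin (w : ℕ) (P : Program) (input : List ℕ) (answer : Prop) (b : ℕ) : Prop :=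
  ∃ (t : ℕ) (s : State), Exec w P (init input) t s ∧ t ≤ b ∧
    (answer → s.reg 0 = 1) ∧ (¬ answer → s.reg 0 = 0)

end WordRAM

/-! ### Graphs as inputs -/

namespace SimpleGraph

/-- `L` is an adjacency list representation of `G`: for each vertex `v`, the list `L v` contains
every neighbour of `v` exactly once, in any order, and nothing else. -/
def IsAdjacencyLists {n : ℕ} (G : SimpleGraph (Fin n)) (L : Fin n → List (Fin n)) : Prop :=
  ∀ v, (L v).Nodup ∧ ∀ u, u ∈ L v ↔ G.Adj v u

/-- The adjacency lists as a list of numbers: the number of vertices, and then for every vertex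
its degree followed by its neighbours. -/
def encodeAdjacencyLists {n : ℕ} (L : Fin n → List (Fin n)) : List ℕ :=
  n :: (List.finRange n).flatMap fun v => (L v).length :: (L v).map Fin.val

end SimpleGraph

/-! ### Triangle-free CDC graphs: a local criterion. -/

namespace SimpleGraph

variable {V : Type*} {G : SimpleGraph V}

/-! In a triangle-free graph the maximal cliques are the edges and the isolated vertices, so the
transversals are the vertex covers containing all isolated vertices. If a set D of nonisolated
vertices is independent, a minimal transversal inside its complement contains every vertex with a
neighbour in D (`exists_subset_mem_dual`); conversely, a nonisolated vertex of a minimal transversal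
has a neighbour outside it (`exists_adj_notMem_of_mem_dual`). These two facts give the criterion
`CliqueFree.isCDC_iff`: every nonisolated w has a neighbour x with N(x) ⊆ N(a) for all neighbours a
of w.

The criterion is tested by brute force on the adjacency matrix and the list of the M = 2|E| arcs
(ordered pairs of adjacent vertices). An arc (w, x) is bad if some arc (x, b) and some vertex a
satisfy a ∈ N(w) and a ∉ N(b). The test fails exactly when all arcs leaving some tail are bad.
Looping over two arcs and a vertex costs O(M²n), the triangle test O(Mn), reading the input O(n²);
all of this is O(n(n + |E|)²).

The input has at most n² + 1 cells. Behind it lie four blocks of length n²: matrix, tails, heads,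
marks. Memory starts at zero, so none of them has to be cleared. Nested loops use increasing counter
registers, and everything from the counter on is scratch for the inner code; this is what `Frame`
records. -/

theorem CliqueFree.not_adj_of_adj_of_adj (hG : G.CliqueFree 3) {u v x : V} (huv : G.Adj u v)
    (hux : G.Adj u x) : ¬ G.Adj v x := fun hvx => by
  classical
  exact hG {u, v, x} (is3Clique_triple_iff.2 ⟨huv, hux, hvx⟩)

theorem cliqueFree_three_iff :
    G.CliqueFree 3 ↔ ∀ u v x, G.Adj u v → G.Adj u x → ¬ G.Adj v x := by
  classical
  refine ⟨fun hG u v x huv hux => hG.not_adj_of_adj_of_adj huv hux, fun h s hs => ?_⟩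
  obtain ⟨u, v, x, huv, hux, hvx, -⟩ := is3Clique_iff.1 hs
  exact h u v x huv hux hvx

theorem pair_mem_cliqueHypergraph (hG : G.CliqueFree 3) {u v : V} (huv : G.Adj u v) :
    ({u, v} : Set V) ∈ G.cliqueHypergraph := by
  refine ⟨isClique_pair.2 fun _ => huv, fun K hK hle x hx => ?_⟩
  by_contra hne
  simp only [Set.mem_insert_iff, Set.mem_singleton_iff, not_or] at hne
  have hu : u ∈ K := hle (by simp)
  have hv : v ∈ K := hle (by simp)
  exact hG.not_adj_of_adj_of_adj huv (hK hu hx (Ne.symm hne.1)) (hK hv hx (Ne.symm hne.2))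

theorem singleton_mem_cliqueHypergraph {u : V} (hu : ∀ v, ¬ G.Adj u v) :
    ({u} : Set V) ∈ G.cliqueHypergraph := by
  refine ⟨isClique_singleton u, fun K hK hle x hx => ?_⟩
  by_contra hne
  exact hu x (hK (hle rfl) hx (Ne.symm hne))

theorem eq_singleton_or_pair_of_mem_cliqueHypergraph (hG : G.CliqueFree 3) {K : Set V}
    (hK : K ∈ G.cliqueHypergraph) {u : V} (hu : u ∈ K) :
    K = {u} ∧ (∀ v, ¬ G.Adj u v) ∨ ∃ v, G.Adj u v ∧ K = {u, v} := by
  by_cases h : ∃ v ∈ K, v ≠ u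
  · obtain ⟨v, hv, hne⟩ := h
    have huv : G.Adj u v := hK.1 hu hv hne.symm
    refine Or.inr ⟨v, huv, ?_⟩
    exact ((pair_mem_cliqueHypergraph hG huv).eq_of_subset hK.1
      (by rintro x (rfl | rfl) <;> assumption)).symm
  · push Not at h
    have hKu : K = {u} := Set.eq_singleton_iff_unique_mem.2 ⟨hu, h⟩
    refine Or.inl ⟨hKu, fun v huv => ?_⟩
    have := hK.2 (y := {u, v}) (isClique_pair.2 fun _ => huv) (by simp [hKu])
    exact huv.ne' (h v (this (by simp)))

/-- A set `T` meets all maximal cliques iff it contains the isolated vertices and is a vertex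
cover. -/
theorem isTransversal_cliqueHypergraph_iff [Nonempty V] (hG : G.CliqueFree 3) {T : Set V} :
    Hypergraph.IsTransversal G.cliqueHypergraph T ↔
      (∀ u, (∀ v, ¬ G.Adj u v) → u ∈ T) ∧ ∀ u v, G.Adj u v → u ∈ T ∨ v ∈ T := by
  constructor
  · refine fun h => ⟨fun u hu => ?_, fun u v huv => ?_⟩
    · obtain ⟨x, hx, hxT⟩ := h _ (singleton_mem_cliqueHypergraph hu)
      exact (Set.mem_singleton_iff.1 hx) ▸ hxT
    · obtain ⟨x, hx, hxT⟩ := h _ (pair_mem_cliqueHypergraph hG huv)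
      rcases hx with rfl | rfl
      exacts [Or.inl hxT, Or.inr hxT]
  · rintro ⟨h1, h2⟩ K hK
    obtain ⟨u, hu⟩ : K.Nonempty := by
      by_contra hne
      rw [Set.not_nonempty_iff_eq_empty] at hne
      subst hne
      obtain ⟨x⟩ := ‹Nonempty V›
      exact hK.2 (y := {x}) (isClique_singleton x) (Set.empty_subset _) (Set.mem_singleton x)
    rcases eq_singleton_or_pair_of_mem_cliqueHypergraph hG hK hu with ⟨rfl, hiso⟩ | ⟨v, huv, rfl⟩
    · exact ⟨u, rfl, h1 u hiso⟩
    · rcases h2 u v huv with h | h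
      exacts [⟨u, by simp, h⟩, ⟨v, by simp, h⟩]

/-- Otherwise u could be deleted from T: it is not isolated, and all edges at u are covered by their
other ends. -/
theorem exists_adj_notMem_of_mem_dual [Nonempty V] (hG : G.CliqueFree 3) {T : Set V}
    (hT : T ∈ Hypergraph.dual G.cliqueHypergraph) {u v : V} (hu : u ∈ T) (huv : G.Adj u v) :
    ∃ x, G.Adj u x ∧ x ∉ T := by
  by_contra! h
  have hT' := (isTransversal_cliqueHypergraph_iff hG).1 hT.1
  have key : Hypergraph.IsTransversal G.cliqueHypergraph (T \ {u}) := by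
    refine (isTransversal_cliqueHypergraph_iff hG).2 ⟨fun x hx => ⟨hT'.1 x hx, ?_⟩, fun x y hxy => ?_⟩
    · rintro rfl
      exact hx v huv
    · by_cases hx : x = u
      · subst hx
        exact Or.inr ⟨h y hxy, hxy.ne'⟩
      · by_cases hy : y = u
        · subst hy
          exact Or.inl ⟨h x hxy.symm, hx⟩
        · exact (hT'.2 x y hxy).imp (fun h => ⟨h, hx⟩) (fun h => ⟨h, hy⟩)
  exact (hT.2 key Set.sdiff_subset hu).2 rfl

/-- The complement of D is a transversal. A minimal one inside it avoids D, so it must cover each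
edge from S into D at its end in S; isolated vertices of S lie in every transversal. -/
theorem exists_subset_mem_dual [Finite V] [Nonempty V] (hG : G.CliqueFree 3) {D S : Set V}
    (hD : ∀ u ∈ D, ∀ v ∈ D, ¬ G.Adj u v) (hDiso : ∀ u ∈ D, ∃ v, G.Adj u v)
    (hS : ∀ s ∈ S, ∀ v, G.Adj s v → ∃ d ∈ D, G.Adj s d) :
    ∃ T ∈ Hypergraph.dual G.cliqueHypergraph, S ⊆ T := by
  have h0 : Hypergraph.IsTransversal G.cliqueHypergraph Dᶜ := by
    refine (isTransversal_cliqueHypergraph_iff hG).2 ⟨fun u hu huD => ?_, fun u v huv => ?_⟩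
    · obtain ⟨v, hv⟩ := hDiso u huD
      exact hu v hv
    · by_contra! h
      simp only [Set.mem_compl_iff, not_not] at h
      exact hD u h.1 v h.2 huv
  obtain ⟨T, hle, hT⟩ := exists_minimal_le_of_wellFoundedLT _ _ h0
  refine ⟨T, hT, fun s hs => ?_⟩
  have hT' := (isTransversal_cliqueHypergraph_iff hG).1 hT.1
  by_cases hiso : ∃ v, G.Adj s v
  · obtain ⟨v, hv⟩ := hiso
    obtain ⟨d, hd, hsd⟩ := hS s hs v hv
    exact (hT'.2 s d hsd).resolve_right fun h => hle h hd
  · push Not at hiso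
    exact hT'.1 s hiso

/-- A triangle-free graph is clique dually conformal iff every nonisolated vertex `w` has a
neighbour whose neighbourhood is contained in that of all other neighbours of `w`. -/
theorem CliqueFree.isCDC_iff [Finite V] [Nonempty V] (hG : G.CliqueFree 3) :
    G.IsCDC ↔ ∀ w y, G.Adj w y →
      ∃ x, G.Adj w x ∧ ∀ a, G.Adj w a → ∀ b, G.Adj x b → G.Adj b a := by
  constructor
  · intro hC w y hwy
    by_contra! hno
    have hpair : ∀ x, G.Adj w x →
        ∃ e ∈ Hypergraph.dual G.cliqueHypergraph, w ∈ e ∧ x ∈ e := by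
      intro x hwx
      obtain ⟨a, hwa, b, hxb, hba⟩ := hno x hwx
      -- The failure of the criterion at x yields the independent set {a, b}, where a is adjacent to
      -- w and b to x.
      obtain ⟨T, hT, hle⟩ := exists_subset_mem_dual hG (D := {a, b}) (S := {w, x})
        (by
          rintro u (rfl | rfl) v (rfl | rfl) <;>
            first | exact G.loopless.irrefl _ | assumption | exact fun h => hba h.symm)
        (by
          rintro u (rfl | rfl)
          exacts [⟨w, hwa.symm⟩, ⟨x, hxb.symm⟩])
        (by
          rintro s (rfl | rfl) v -
          exacts [⟨a, by simp, hwa⟩, ⟨b, by simp, hxb⟩])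
      exact ⟨T, hT, hle (by simp), hle (by simp)⟩
    -- Conformality is applied to the closed neighbourhood of w. Two neighbours of w share a
    -- hyperedge because of D = {w}.
    obtain ⟨T, hT, hle⟩ := hC (insert w {x | G.Adj w x}) (by
      rintro u (rfl | hu) v (rfl | hv) huv
      · exact absurd rfl huv
      · exact hpair v hv
      · obtain ⟨e, he, h1, h2⟩ := hpair u hu
        exact ⟨e, he, h2, h1⟩
      · obtain ⟨T, hT, hle⟩ := exists_subset_mem_dual hG (D := {w}) (S := {u, v})
          (by
            rintro x rfl y rfl
            exact G.loopless.irrefl _)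
          (by
            rintro x rfl
            exact ⟨_, hwy⟩)
          (by
            rintro s (rfl | rfl) - -
            exacts [⟨w, rfl, hu.symm⟩, ⟨w, rfl, hv.symm⟩])
        exact ⟨T, hT, hle (by simp), hle (by simp)⟩)
    -- A minimal transversal cannot contain w together with all its neighbours.
    obtain ⟨x, hwx, hx⟩ := exists_adj_notMem_of_mem_dual hG hT (hle (Set.mem_insert _ _)) hwy
    exact hx (hle (Or.inr hwx))
  · intro h S hS
    choose! f hf using fun w (hw : ∃ y, G.Adj w y) => h w hw.choose hw.choose_spec
    refine exists_subset_mem_dual hG (D := f '' {s | s ∈ S ∧ ∃ y, G.Adj s y}) ?_ ?_ ?_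
    · rintro _ ⟨s, ⟨hs, hsy⟩, rfl⟩ _ ⟨t, ⟨ht, hty⟩, rfl⟩ hadj
      have hst : s ≠ t := by
        rintro rfl
        exact G.loopless.irrefl _ hadj
      obtain ⟨T, hT, hsT, htT⟩ := hS s hs t ht hst
      obtain ⟨a, hsa, haT⟩ := exists_adj_notMem_of_mem_dual hG hT hsT hsy.choose_spec
      obtain ⟨b, htb, hbT⟩ := exists_adj_notMem_of_mem_dual hG hT htT hty.choose_spec
      -- If f s and f t are adjacent, then f t ∈ N(f s) ⊆ N(a), hence a ∈ N(f t) ⊆ N(b), and the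
      -- edge ab is not covered by T.
      have h1 := (hf s hsy).2 a hsa _ hadj
      have h2 := (hf t hty).2 b htb _ h1
      exact (((isTransversal_cliqueHypergraph_iff hG).1 hT.1).2 a b h2).elim haT hbT
    · rintro _ ⟨s, ⟨hs, hsy⟩, rfl⟩
      exact ⟨s, (hf s hsy).1.symm⟩
    · intro s hs v hv
      exact ⟨f s, ⟨s, ⟨hs, v, hv⟩, rfl⟩, (hf s ⟨v, hv⟩).1⟩

end SimpleGraph

/-! ### Correctness and cost rules for programs. -/

namespace WordRAM

@[simp] theorem State.setReg_reg (s : State) (x a r : ℕ) :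
    (s.setReg x a).reg r = if r = x then a else s.reg r := by
  simp [State.setReg, Function.update_apply]

@[simp] theorem State.setReg_mem (s : State) (x a : ℕ) : (s.setReg x a).mem = s.mem := rfl

@[simp] theorem State.setMem_reg (s : State) (i a : ℕ) : (s.setMem i a).reg = s.reg := rfl

@[simp] theorem State.setMem_mem (s : State) (i a : ℕ) :
    (s.setMem i a).mem = Function.update s.mem i a := rfl

/-- Started in `s`, the program `P` halts within `c` steps in a state satisfying `post`. -/
def Ensures (w : ℕ) (P : Program) (s : State) (c : ℕ) (post : State → Prop) : Prop :=
  ∃ t s', Exec w P s t s' ∧ t ≤ c ∧ post s'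

variable {w c c' : ℕ} {P Q : Program} {s : State} {post post' : State → Prop}

theorem Ensures.mono (h : Ensures w P s c post) (hc : c ≤ c')
    (hp : ∀ s', post s' → post' s') : Ensures w P s c' post' := by
  obtain ⟨t, s', he, ht, hs⟩ := h
  exact ⟨t, s', he, ht.trans hc, hp s' hs⟩

namespace Ensures

theorem skip (h : post s) : Ensures w .skip s 1 post := ⟨1, s, .skip s, le_rfl, h⟩

theorem const {x k : ℕ} (hk : k < 2 ^ w) (h : post (s.setReg x k)) :
    Ensures w (.const x k) s 1 post := ⟨1, _, .const s x k hk, le_rfl, h⟩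

theorem add {x y z : ℕ} (hk : s.reg y + s.reg z < 2 ^ w)
    (h : post (s.setReg x (s.reg y + s.reg z))) :
    Ensures w (.add x y z) s 1 post := ⟨1, _, .add s x y z hk, le_rfl, h⟩

theorem sub {x y z : ℕ} (h : post (s.setReg x (s.reg y - s.reg z))) :
    Ensures w (.sub x y z) s 1 post := ⟨1, _, .sub s x y z, le_rfl, h⟩

theorem mul {x y z : ℕ} (hk : s.reg y * s.reg z < 2 ^ w)
    (h : post (s.setReg x (s.reg y * s.reg z))) :
    Ensures w (.mul x y z) s 1 post := ⟨1, _, .mul s x y z hk, le_rfl, h⟩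

theorem load {x y : ℕ} (h : post (s.setReg x (s.mem (s.reg y)))) :
    Ensures w (.load x y) s 1 post := ⟨1, _, .load s x y, le_rfl, h⟩

theorem store {x y : ℕ} (h : post (s.setMem (s.reg x) (s.reg y))) :
    Ensures w (.store x y) s 1 post := ⟨1, _, .store s x y, le_rfl, h⟩

theorem seq (h : Ensures w P s c fun s' => Ensures w Q s' c' post) :
    Ensures w (.seq P Q) s (c + c') post := by
  obtain ⟨t, s', he, ht, t', s'', he', ht', hp⟩ := h
  exact ⟨t + t', s'', .seq he he', by omega, hp⟩

theorem ifLt {x y : ℕ} (h1 : s.reg x < s.reg y → Ensures w P s c post)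
    (h2 : ¬ s.reg x < s.reg y → Ensures w Q s c post) :
    Ensures w (.ifLt x y P Q) s (1 + c) post := by
  by_cases h : s.reg x < s.reg y
  · obtain ⟨t, s', he, ht, hp⟩ := h1 h
    exact ⟨1 + t, s', .ifTrue h he, by omega, hp⟩
  · obtain ⟨t, s', he, ht, hp⟩ := h2 h
    exact ⟨1 + t, s', .ifFalse h he, by omega, hp⟩

end Ensures

/-- `for i < r do body`; register `1` has to hold `1`. -/
def Program.forLt (i r : ℕ) (body : Program) : Program :=
  .seq (.const i 0) (.whileLt i r (.seq body (.add i i 1)))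

/-- `I j` describes the state when the test is made with counter j. A round costs the body plus test
and increment; the summand 2 pays for the initialization and the last test. The bound on k lets the
counter fit into a word. -/
theorem Ensures.forLt {i r k : ℕ} {body : Program} (I : ℕ → State → Prop) (hk : k < 2 ^ w)
    (h0 : I 0 (s.setReg i 0))
    (hI : ∀ j s, I j s → s.reg i = j ∧ s.reg r = k)
    (step : ∀ j < k, ∀ s, I j s →
      Ensures w body s c fun s' => s'.reg i = j ∧ s'.reg 1 = 1 ∧ I (j + 1) (s'.setReg i (j + 1))) :
    Ensures w (.forLt i r body) s (k * (c + 2) + 2) (I k) := by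
  -- Induction on the number m of remaining rounds.
  have loop : ∀ m j s, j + m = k → I j s →
      Ensures w (.whileLt i r (.seq body (.add i i 1))) s (m * (c + 2) + 1) (I k) := by
    intro m
    induction m with
    | zero =>
      intro j s hj hs
      obtain ⟨h1, h2⟩ := hI j s hs
      obtain rfl : j = k := by omega
      exact ⟨1, s, .whileFalse (by omega), by omega, hs⟩
    | succ m ih =>
      intro j s hj hs
      obtain ⟨h1, h2⟩ := hI j s hs
      obtain ⟨t, s', he, ht, h3, h4, h5⟩ := step j (by omega) s hs
      obtain ⟨t', s'', he', ht', h6⟩ := ih (j + 1) _ (by omega) h5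
      have hadd : Exec w (.add i i 1) s' 1 (s'.setReg i (j + 1)) := by
        have := Exec.add (w := w) s' i i 1 (by omega)
        rwa [h3, h4] at this
      refine ⟨1 + (t + 1) + t', s'', .whileTrue (by omega) (.seq he hadd) he', ?_, h6⟩
      rw [Nat.succ_mul]
      omega
  refine (Ensures.seq (c := 1) (c' := k * (c + 2) + 1)
    (Ensures.const (by omega) (loop k 0 _ (by omega) h0))).mono (by omega) fun _ h => h

/-- `s'` differs from `s` only in the flag register `f` and in registers from `K` on. -/
def Frame (K f : ℕ) (s s' : State) : Prop :=
  s'.mem = s.mem ∧ ∀ r < K, r ≠ f → s'.reg r = s.reg r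

/-- Within `c` steps, the program `P` sets the flag register `f` to `1` if `φ` is true, and leaves
it alone if `φ` is false; nothing else changes, except registers from `K` on. -/
def Raises (w K f : ℕ) (P : Program) (c : ℕ) (φ : Prop) (s : State) : Prop :=
  Ensures w P s c fun s' =>
    Frame K f s s' ∧ (φ → s'.reg f = 1) ∧ (¬ φ → s'.reg f = s.reg f)

/-- A bounded existential quantifier becomes a loop whose body never lowers the flag. The body may
change registers above i, the loop those from i on, so loops nest. -/
theorem Raises.forLt {i f r k : ℕ} {body : Program} {φ : ℕ → Prop}
    (hfi : f < i) (hri : r < i) (hrf : r ≠ f) (h1i : 1 < i) (h1f : 1 ≠ f) (hk : k < 2 ^ w)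
    (hr : s.reg r = k) (h1 : s.reg 1 = 1)
    (step : ∀ j < k, ∀ s', Frame i f s s' → s'.reg i = j →
      Raises w (i + 1) f body c (φ j) s') :
    Raises w i f (.forLt i r body) (k * (c + 2) + 2) (∃ j < k, φ j) s := by
  refine (Ensures.forLt (I := fun j s' => s'.reg i = j ∧ Frame i f s s' ∧
    ((∃ j' < j, φ j') → s'.reg f = 1) ∧ ((¬ ∃ j' < j, φ j') → s'.reg f = s.reg f)) hk ?_ ?_ ?_).mono
    le_rfl fun s' h => h.2
  · refine ⟨by simp, ⟨rfl, fun r' hr' _ => ?_⟩, by simp, fun _ => ?_⟩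
    · simp [hr'.ne]
    · simp [hfi.ne]
  · rintro j s' ⟨h, hF, -⟩
    exact ⟨h, (hF.2 r hri hrf).trans hr⟩
  · rintro j hj s' ⟨h, hF, hf1, hf2⟩
    refine (step j hj s' hF h).mono le_rfl ?_
    rintro s'' ⟨hF', hf1', hf2'⟩
    refine ⟨(hF'.2 i (by omega) hfi.ne').trans h, ?_, by simp, ⟨?_, ?_⟩, ?_, ?_⟩
    · rw [hF'.2 1 (by omega) h1f, hF.2 1 h1i h1f, h1]
    · exact hF'.1.trans hF.1
    · intro r' hr' hrf'
      simp only [State.setReg_reg, hr'.ne, if_false]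
      rw [hF'.2 r' (by omega) hrf', hF.2 r' hr' hrf']
    · rintro ⟨j', hj', hφ⟩
      simp only [State.setReg_reg, hfi.ne, if_false]
      by_cases hφj : φ j
      · exact hf1' hφj
      · rw [hf2' hφj]
        exact hf1 ⟨j', by
          rcases Nat.lt_succ_iff_lt_or_eq.1 hj' with h | rfl
          · exact h
          · exact absurd hφ hφj, hφ⟩
    · intro hno
      simp only [State.setReg_reg, hfi.ne, if_false]
      rw [hf2' fun h => hno ⟨j, by omega, h⟩, hf2 fun ⟨j', hj', h⟩ => hno ⟨j', by omega, h⟩]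

end WordRAM

namespace WordRAM

section Rules

variable {w K K' f c c' : ℕ} {P Q : Program} {φ ψ : Prop} {s s' s'' : State}

theorem Frame.refl (K f : ℕ) (s : State) : Frame K f s s := ⟨rfl, fun _ _ _ => rfl⟩

theorem Frame.trans (h : Frame K f s s') (h' : Frame K f s' s'') : Frame K f s s'' :=
  ⟨h'.1.trans h.1, fun r hr hrf => (h'.2 r hr hrf).trans (h.2 r hr hrf)⟩

theorem Frame.mono (h : Frame K f s s') (hK : K' ≤ K) : Frame K' f s s' :=
  ⟨h.1, fun r hr => h.2 r (hr.trans_le hK)⟩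

theorem Raises.mono (h : Raises w K f P c φ s) (hK : K' ≤ K) (hc : c ≤ c') (hφ : φ ↔ ψ) :
    Raises w K' f P c' ψ s :=
  Ensures.mono h hc fun _ hs => ⟨hs.1.mono hK, by rw [← hφ]; exact hs.2⟩

theorem Raises.skip (hc : 1 ≤ c) (h : ¬ φ) : Raises w K f .skip c φ s :=
  (Ensures.skip ⟨.refl _ _ _, fun h' => absurd h' h, fun _ => rfl⟩).mono hc fun _ h => h

theorem Raises.set (hw : 1 < 2 ^ w) (h : φ) : Raises w K f (.const f 1) 1 φ s :=
  Ensures.const hw ⟨⟨rfl, fun r _ hr => by simp [hr]⟩, fun _ => by simp, fun h' => absurd h h'⟩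

theorem Raises.ifLt {x y : ℕ} (h1 : s.reg x < s.reg y → Raises w K f P c φ s)
    (h2 : ¬ s.reg x < s.reg y → Raises w K f Q c φ s) :
    Raises w K f (.ifLt x y P Q) (1 + c) φ s := Ensures.ifLt h1 h2

theorem Raises.seq (h : Ensures w P s c fun s' =>
      Frame K f s s' ∧ s'.reg f = s.reg f ∧ Raises w K f Q c' φ s') :
    Raises w K f (.seq P Q) (c + c') φ s :=
  Ensures.seq (h.mono le_rfl fun _ ⟨hF, hf, hR⟩ =>
    Ensures.mono hR le_rfl fun _ ⟨hF', h1, h2⟩ =>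
      ⟨hF.trans hF', h1, fun hφ => (h2 hφ).trans hf⟩)

end Rules

/-! ### The tests on the adjacency matrix and the arc list. -/

/-- The registers and the memory of `s` hold a graph on `{0, …, n - 1}` with adjacency relation
`A`, given by its adjacency matrix and by the list of its `M` arcs. -/
structure GraphState (n M : ℕ) (src dst : ℕ → ℕ) (A : ℕ → ℕ → Prop) (s : State) : Prop where
  one : s.reg 1 = 1
  card : s.reg 2 = n
  adjBase : s.reg 3 = n * n + 1
  arcs : s.reg 5 = M
  srcBase : s.reg 6 = 2 * (n * n) + 1
  dstBase : s.reg 7 = 3 * (n * n) + 1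
  goodBase : s.reg 8 = 4 * (n * n) + 1
  arcs_le : M ≤ n * n
  src_lt : ∀ k < M, src k < n
  dst_lt : ∀ k < M, dst k < n
  src_mem : ∀ k < M, s.mem (2 * (n * n) + 1 + k) = src k
  dst_mem : ∀ k < M, s.mem (3 * (n * n) + 1 + k) = dst k
  adj_mem : ∀ u < n, ∀ v < n, s.mem (n * n + 1 + (u * n + v)) < 1 ↔ ¬ A u v

theorem mul_add_lt_mul {n u v : ℕ} (hu : u < n) (hv : v < n) : u * n + v < n * n :=
  calc u * n + v < (u + 1) * n := by rw [Nat.succ_mul]; omega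
    _ ≤ n * n := Nat.mul_le_mul_right n hu

section Graph

variable {w n M : ℕ} {src dst : ℕ → ℕ} {A : ℕ → ℕ → Prop} {s s' : State}

theorem GraphState.frame {K f : ℕ} (h : GraphState n M src dst A s) (hF : Frame K f s s')
    (hK : 9 ≤ K) (hf : f = 4 ∨ 9 ≤ f) : GraphState n M src dst A s' := by
  obtain ⟨hm, hr⟩ := hF
  constructor
  case one => rw [hr _ (by omega) (by omega)]; exact h.one
  case card => rw [hr _ (by omega) (by omega)]; exact h.card
  case adjBase => rw [hr _ (by omega) (by omega)]; exact h.adjBase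
  case arcs => rw [hr _ (by omega) (by omega)]; exact h.arcs
  case srcBase => rw [hr _ (by omega) (by omega)]; exact h.srcBase
  case dstBase => rw [hr _ (by omega) (by omega)]; exact h.dstBase
  case goodBase => rw [hr _ (by omega) (by omega)]; exact h.goodBase
  case arcs_le => exact h.arcs_le
  case src_lt => exact h.src_lt
  case dst_lt => exact h.dst_lt
  case src_mem => rw [hm]; exact h.src_mem
  case dst_mem => rw [hm]; exact h.dst_mem
  case adj_mem => rw [hm]; exact h.adj_mem

/-- Load the end vertices of the arc number `p` into `a` and `b`. -/
def Program.loadArc (p a b t : ℕ) : Program :=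
  .seq (.add t 6 p) (.seq (.load a t) (.seq (.add t 7 p) (.load b t)))

theorem GraphState.loadArc {p a b t k K f : ℕ} (h : GraphState n M src dst A s)
    (hw : 5 * (n * n) + 10 ≤ 2 ^ w) (hp : s.reg p = k) (hk : k < M)
    (hpa : p < a) (hab : a < b) (hbt : b < t) (ha : 9 ≤ a) (hK : K ≤ a)
    (hf : f < a) :
    Ensures w (.loadArc p a b t) s 4 fun s' =>
      Frame K f s s' ∧ s'.reg f = s.reg f ∧ s'.reg a = src k ∧ s'.reg b = dst k := by
  have h1 := h.srcBase
  have h2 := h.dstBase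
  have h3 := h.arcs_le
  have h4 := h.src_mem k hk
  have h5 := h.dst_mem k hk
  have e1 : p ≠ t := by omega
  have e2 : p ≠ a := by omega
  have e3 : a ≠ b := by omega
  have e4 : a ≠ t := by omega
  have e5 : 7 ≠ a := by omega
  have e6 : 7 ≠ t := by omega
  have e7 : f ≠ a := by omega
  have e8 : f ≠ b := by omega
  have e9 : f ≠ t := by omega
  refine Ensures.seq (c := 1) (c' := 3) <| .add ?_ <| .seq (c := 1) (c' := 2) <| .load <|
    .seq (c := 1) (c' := 1) <| .add ?_ <| .load ?_
  · omega
  · simp only [State.setReg_reg, e5, e6, e1, e2, if_false]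
    omega
  · simp only [Frame, State.setReg_reg, State.setReg_mem, e5, e6, e1, e2, e3, e4, e7, e8, e9,
      if_false, if_true, h1, h2, hp, h4, h5, and_true, true_and]
    intro r hr _
    simp [show r ≠ a by omega, show r ≠ b by omega, show r ≠ t by omega]

/-- Load the entry of the adjacency matrix for the vertices in `u` and `v` into `t`. -/
def Program.loadAdj (u v t : ℕ) : Program :=
  .seq (.mul t u 2) (.seq (.add t t v) (.seq (.add t 3 t) (.load t t)))

theorem GraphState.loadAdj {u v t x y K f : ℕ} (h : GraphState n M src dst A s)
    (hw : 5 * (n * n) + 10 ≤ 2 ^ w) (hu : s.reg u = x) (hv : s.reg v = y) (hx : x < n) (hy : y < n)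
    (hvt : v < t) (ht : 9 ≤ t) (hK : K ≤ t) (hf : f < t) :
    Ensures w (.loadAdj u v t) s 4 fun s' =>
      Frame K f s s' ∧ s'.reg f = s.reg f ∧ (s'.reg t < s'.reg 1 ↔ ¬ A x y) := by
  have h1 := h.adjBase
  have h2 := h.card
  have h3 := mul_add_lt_mul hx hy
  have h4 := h.adj_mem x hx y hy
  have e1 : v ≠ t := by omega
  have e2 : 3 ≠ t := by omega
  have e3 : 1 ≠ t := by omega
  have e4 : f ≠ t := by omega
  refine Ensures.seq (c := 1) (c' := 3) <| .mul ?_ <| .seq (c := 1) (c' := 2) <| .add ?_ <|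
    .seq (c := 1) (c' := 1) <| .add ?_ <| .load ?_
  · rw [hu, h2]; omega
  · simp only [State.setReg_reg, e1, if_false, if_true, hu, hv, h2]
    omega
  · simp only [State.setReg_reg, e1, e2, if_false, if_true, hu, hv, h1, h2]
    omega
  · simp only [Frame, State.setReg_reg, State.setReg_mem, e1, e2, e3, e4,
      if_false, if_true, h1, h2, hu, hv, h4, h.one, and_true, true_and]
    intro r hr _
    simp [show r ≠ t by omega]

/-- Raise register `4` if the graph has a triangle. -/
def Program.findTriangle : Program :=
  .forLt 10 5 <| .seq (.loadArc 10 11 12 25) <| .forLt 21 2 <|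
    .seq (.loadAdj 11 21 25) <| .ifLt 25 1 .skip <|
      .seq (.loadAdj 12 21 25) <| .ifLt 25 1 .skip (.const 4 1)

theorem GraphState.findTriangle (h : GraphState n M src dst A s) (hw : 5 * (n * n) + 10 ≤ 2 ^ w)
    (hn : n < 2 ^ w) :
    Raises w 10 4 .findTriangle (M * (n * 13 + 8) + 2)
      (∃ p < M, ∃ a < n, A (src p) a ∧ A (dst p) a) s := by
  have hM := h.arcs_le
  -- An inner round costs 13: two matrix lookups of 4 steps, two tests, one final instruction and
  -- the loop overhead 2.
  refine (Raises.forLt (c := 4 + (n * ((4 + (1 + (4 + (1 + 1)))) + 2) + 2)) (by omega) (by omega)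
    (by omega) (by omega) (by omega) (by omega) h.arcs h.one ?_).mono le_rfl (by ring_nf; omega)
    Iff.rfl
  intro p hp s1 hF1 hp1
  have g1 := h.frame hF1 (by omega) (by omega)
  refine Raises.seq ((g1.loadArc (K := 11) (f := 4) hw hp1 hp (by omega) (by omega) (by omega)
    (by omega) (by omega) (by omega)).mono le_rfl ?_)
  rintro s2 ⟨hF2, hf2, hs2, hd2⟩
  have g2 := g1.frame hF2 (by omega) (by omega)
  refine ⟨hF2, hf2, Raises.mono (K := 21) (Raises.forLt
    (c := 4 + (1 + (4 + (1 + 1)))) (φ := fun a => A (src p) a ∧ A (dst p) a) (by omega) (by omega)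
    (by omega) (by omega) (by omega) hn g2.card g2.one ?_) (by omega) le_rfl Iff.rfl⟩
  intro a ha s3 hF3 ha3
  have g3 := g2.frame hF3 (by omega) (by omega)
  refine Raises.seq ((g3.loadAdj (K := 22) (f := 4) hw ((hF3.2 11 (by omega) (by omega)).trans hs2)
    ha3 (g3.src_lt p hp) ha (by omega) (by omega) (by omega) (by omega)).mono le_rfl ?_)
  rintro s4 ⟨hF4, hf4, ht4⟩
  have g4 := g3.frame hF4 (by omega) (by omega)
  refine ⟨hF4, hf4, Raises.ifLt (fun hlt => Raises.skip (by omega) fun hA => ht4.1 hlt hA.1) fun hlt => ?_⟩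
  have hA1 := not_not.1 fun hA => hlt (ht4.2 hA)
  refine Raises.seq ((g4.loadAdj (K := 22) (f := 4) hw (((hF4.2 12 (by omega) (by omega)).trans
    (hF3.2 12 (by omega) (by omega))).trans hd2) ((hF4.2 21 (by omega) (by omega)).trans ha3)
    (g4.dst_lt p hp) ha (by omega) (by omega) (by omega) (by omega)).mono le_rfl ?_)
  rintro s5 ⟨hF5, hf5, ht5⟩
  exact ⟨hF5, hf5, Raises.ifLt (fun hlt => Raises.skip le_rfl fun hA => ht5.1 hlt hA.2)
    fun hlt => Raises.set (by omega) ⟨hA1, not_not.1 fun hA => hlt (ht5.2 hA)⟩⟩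

/-- The arc number `p` does not lead to a vertex whose neighbourhood is contained in the
neighbourhoods of all other neighbours of the tail. -/
def BadArc (n M : ℕ) (src dst : ℕ → ℕ) (A : ℕ → ℕ → Prop) (p : ℕ) : Prop :=
  ∃ q < M, src q = dst p ∧ ∃ a < n, A (src p) a ∧ ¬ A (dst q) a

/-- Raise register `17` if the arc from `11` to `12` is bad. -/
def Program.testArc : Program :=
  .forLt 18 5 <| .seq (.loadArc 18 19 20 25) <| .ifLt 19 12 .skip <| .ifLt 12 19 .skip <|
    .forLt 21 2 <| .seq (.loadAdj 11 21 25) <| .ifLt 25 1 .skip <|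
      .seq (.loadAdj 20 21 25) <| .ifLt 25 1 (.const 17 1) .skip

theorem GraphState.testArc {p : ℕ} (h : GraphState n M src dst A s)
    (hw : 5 * (n * n) + 10 ≤ 2 ^ w) (hn : n < 2 ^ w) (hp : p < M)
    (hs : s.reg 11 = src p) (hd : s.reg 12 = dst p) :
    Raises w 18 17 .testArc (M * (n * 13 + 10) + 2) (BadArc n M src dst A p) s := by
  have hM := h.arcs_le
  refine (Raises.forLt (c := 4 + (1 + (1 + (n * ((4 + (1 + (4 + (1 + 1)))) + 2) + 2)))) (by omega)
    (by omega) (by omega) (by omega) (by omega) (by omega) h.arcs h.one ?_).mono le_rfl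
    (by ring_nf; omega) Iff.rfl
  intro q hq s1 hF1 hq1
  have g1 := h.frame hF1 (by omega) (by omega)
  refine Raises.seq ((g1.loadArc (K := 19) (f := 17) hw hq1 hq (by omega) (by omega) (by omega)
    (by omega) (by omega) (by omega)).mono le_rfl ?_)
  rintro s2 ⟨hF2, hf2, hs2, hd2⟩
  have g2 := g1.frame hF2 (by omega) (by omega)
  have hu2 : s2.reg 11 = src p :=
    ((hF2.2 11 (by omega) (by omega)).trans (hF1.2 11 (by omega) (by omega))).trans hs
  have hv2 : s2.reg 12 = dst p :=
    ((hF2.2 12 (by omega) (by omega)).trans (hF1.2 12 (by omega) (by omega))).trans hd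
  -- Equality of the tail of q with the head of p is tested by two strict comparisons.
  refine ⟨hF2, hf2, Raises.ifLt (fun hlt => Raises.skip (by omega) fun hA => ?_) fun hlt => Raises.ifLt (fun hlt' => Raises.skip (by omega) fun hA => ?_) fun hlt' => ?_⟩
  · have := hA.1
    omega
  · have := hA.1
    omega
  have heq : src q = dst p := by omega
  refine (Raises.forLt (c := 4 + (1 + (4 + (1 + 1)))) (φ := fun a => A (src p) a ∧ ¬ A (dst q) a)
    (by omega) (by omega) (by omega) (by omega) (by omega) hn g2.card g2.one ?_).mono (K := 21) (by omega) le_rfl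
    (φ := ∃ a < n, A (src p) a ∧ ¬ A (dst q) a) ⟨fun h => ⟨heq, h⟩, fun h => h.2⟩
  intro a ha s3 hF3 ha3
  have g3 := g2.frame hF3 (by omega) (by omega)
  refine Raises.seq ((g3.loadAdj (K := 22) (f := 17) hw
    ((hF3.2 11 (by omega) (by omega)).trans hu2)
    ha3 (g3.src_lt p hp) ha (by omega) (by omega) (by omega) (by omega)).mono le_rfl ?_)
  rintro s4 ⟨hF4, hf4, ht4⟩
  have g4 := g3.frame hF4 (by omega) (by omega)
  refine ⟨hF4, hf4, Raises.ifLt (fun hlt => Raises.skip (by omega) fun hA => ht4.1 hlt hA.1) fun hlt => ?_⟩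
  have hA1 := not_not.1 fun hA => hlt (ht4.2 hA)
  refine Raises.seq ((g4.loadAdj (K := 22) (f := 17) hw (((hF4.2 20 (by omega) (by omega)).trans
    (hF3.2 20 (by omega) (by omega))).trans hd2) ((hF4.2 21 (by omega) (by omega)).trans ha3)
    (g4.dst_lt q hq) ha (by omega) (by omega) (by omega) (by omega)).mono le_rfl ?_)
  rintro s5 ⟨hF5, hf5, ht5⟩
  exact ⟨hF5, hf5, Raises.ifLt (fun hlt => Raises.set (by omega) ⟨hA1, ht5.1 hlt⟩)
    fun hlt => Raises.skip le_rfl fun hA => hlt (ht5.2 hA.2)⟩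

/-- Mark the tails of all arcs that are not bad. -/
def Program.markGood : Program :=
  .forLt 10 5 <| .seq (.loadArc 10 11 12 25) <| .seq (.const 17 0) <| .seq .testArc <|
    .ifLt 17 1 (.seq (.add 25 8 11) (.store 25 1)) .skip

/-- The marks lie behind the matrix and both arc blocks, since M ≤ n². -/
theorem GraphState.setMem_good {i a : ℕ} (h : GraphState n M src dst A s) :
    GraphState n M src dst A (s.setMem (4 * (n * n) + 1 + i) a) where
  one := h.one
  card := h.card
  adjBase := h.adjBase
  arcs := h.arcs
  srcBase := h.srcBase
  dstBase := h.dstBase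
  goodBase := h.goodBase
  arcs_le := h.arcs_le
  src_lt := h.src_lt
  dst_lt := h.dst_lt
  src_mem k hk := by
    have := h.arcs_le
    rw [State.setMem_mem, Function.update_of_ne (by omega)]
    exact h.src_mem k hk
  dst_mem k hk := by
    have := h.arcs_le
    rw [State.setMem_mem, Function.update_of_ne (by omega)]
    exact h.dst_mem k hk
  adj_mem u hu v hv := by
    have := mul_add_lt_mul hu hv
    rw [State.setMem_mem, Function.update_of_ne (by omega)]
    exact h.adj_mem u hu v hv

theorem GraphState.markGood (h : GraphState n M src dst A s) (hw : 5 * (n * n) + 10 ≤ 2 ^ w)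
    (hn : n < 2 ^ w) (hgood : ∀ u < n, s.mem (4 * (n * n) + 1 + u) = 0) :
    Ensures w .markGood s (M * (M * (n * 13 + 10) + 12) + 2) fun s' =>
      GraphState n M src dst A s' ∧ s'.reg 4 = s.reg 4 ∧
      ∀ u < n, s'.mem (4 * (n * n) + 1 + u) < 1 ↔
        ¬ ∃ p < M, src p = u ∧ ¬ BadArc n M src dst A p := by
  have hM := h.arcs_le
  -- Invariant: after j arcs, a vertex is unmarked iff none of these arcs is a good one leaving it.
  refine (Ensures.forLt (c := 4 + (1 + ((M * (n * 13 + 10) + 2) + (1 + (1 + 1)))))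
    (I := fun j s' => s'.reg 10 = j ∧ GraphState n M src dst A s' ∧ s'.reg 4 = s.reg 4 ∧
      ∀ u < n, s'.mem (4 * (n * n) + 1 + u) < 1 ↔
        ¬ ∃ p < j, src p = u ∧ ¬ BadArc n M src dst A p) (k := M) (by omega) ?_ ?_ ?_).mono
    (by ring_nf; omega) fun s' h => h.2
  · refine ⟨by simp, h.frame (K := 10) (f := 4) ⟨rfl, fun r hr _ => ?_⟩ (by omega) (by omega),
      by simp, fun u hu => ?_⟩
    · simp [hr.ne]
    · simp [hgood u hu]
  · rintro j s' ⟨h1, h2, -⟩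
    exact ⟨h1, h2.arcs⟩
  rintro p hp s1 ⟨hp1, g1, h41, hm1⟩
  -- Register 9 is a dummy flag here, so that the frame also protects register 4, which holds the
  -- result of the triangle test.
  refine Ensures.seq ((g1.loadArc (K := 11) (f := 9) hw hp1 hp (by omega) (by omega) (by omega)
    (by omega) (by omega) (by omega)).mono le_rfl ?_)
  rintro s2 ⟨hF2, -, hs2, hd2⟩
  have g2 := g1.frame hF2 (by omega) (by omega)
  refine .seq (.const (by omega) ?_)
  have hF3 : Frame 17 17 s2 (s2.setReg 17 0) := ⟨rfl, fun r hr _ => by simp [hr.ne]⟩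
  have hf3 : (s2.setReg 17 0).reg 17 = 0 := by simp
  generalize s2.setReg 17 0 = s3 at hF3 hf3
  have g3 := g2.frame hF3 (by omega) (by omega)
  have hs3 := (hF3.2 11 (by omega) (by omega)).trans hs2
  have hd3 := (hF3.2 12 (by omega) (by omega)).trans hd2
  refine .seq (Ensures.mono (g3.testArc hw hn hp hs3 hd3) le_rfl ?_)
  rintro s4 ⟨hF4, h4, h4'⟩
  have g4 := g3.frame hF4 (by omega) (by omega)
  have hs4 := (hF4.2 11 (by omega) (by omega)).trans hs3
  have hmem : s4.mem = s1.mem := (hF4.1.trans hF3.1).trans hF2.1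
  have hp4 : s4.reg 10 = p := by
    rw [hF4.2 _ (by omega) (by omega), hF3.2 _ (by omega) (by omega),
      hF2.2 _ (by omega) (by omega), hp1]
  have h44 : s4.reg 4 = s.reg 4 := by
    rw [hF4.2 _ (by omega) (by omega), hF3.2 _ (by omega) (by omega),
      hF2.2 _ (by omega) (by omega), h41]
  have hsp := g4.src_lt p hp
  have hnn : n ≤ n * n := Nat.le_mul_self n
  have frame10 : ∀ (s' : State) (x : ℕ), Frame 10 4 s' (s'.setReg 10 x) :=
    fun s' x => ⟨rfl, fun r hr _ => by simp [hr.ne]⟩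
  have hsplit : ∀ u, (∃ p' < p + 1, src p' = u ∧ ¬ BadArc n M src dst A p') ↔
      (∃ p' < p, src p' = u ∧ ¬ BadArc n M src dst A p') ∨
        (src p = u ∧ ¬ BadArc n M src dst A p) := by
    intro u
    simp only [Nat.lt_succ_iff_lt_or_eq, or_and_right, exists_or, exists_eq_left]
  by_cases hbad : BadArc n M src dst A p
  · have hf4 := h4 hbad
    refine .ifLt (fun hlt => absurd hlt (by rw [hf4, g4.one]; omega)) fun _ =>
      (Ensures.skip ?_).mono (by omega) fun _ h => h
    refine ⟨hp4, g4.one, by simp, g4.frame (frame10 _ _) (by omega) (by omega), by simpa using h44,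
      fun u hu => ?_⟩
    rw [State.setReg_mem, hmem, hm1 u hu, hsplit]
    simp [hbad]
  · have hf4 := (h4' hbad).trans hf3
    refine .ifLt (fun _ => .seq (.add (by rw [g4.goodBase]; omega) (.store ?_))) fun hlt =>
      absurd (show s4.reg 17 < s4.reg 1 by rw [hf4, g4.one]; omega) hlt
    simp only [State.setReg_reg, if_true, g4.goodBase, hs4]
    have hF5 : Frame 25 4 s4 (s4.setReg 25 (4 * (n * n) + 1 + src p)) :=
      ⟨rfl, fun r hr _ => by simp [hr.ne]⟩
    refine ⟨by simpa using hp4, by simpa using g4.one, by simp,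
      (g4.frame hF5 (by omega) (by omega)).setMem_good.frame (frame10 _ _) (by omega) (by omega),
      by simpa using h44, fun u hu => ?_⟩
    rw [hsplit]
    by_cases hu' : src p = u
    · subst hu'
      simp [hbad, g4.one]
    · simp only [State.setReg_mem, State.setMem_mem]
      rw [Function.update_of_ne (by omega), hmem, hm1 u hu]
      simp [hu']

/-- Raise register `4` if the tail of some arc is not marked. -/
def Program.findUnmarked : Program :=
  .forLt 10 5 <| .seq (.loadArc 10 11 12 25) <| .seq (.add 25 8 11) <| .seq (.load 25 25) <|
    .ifLt 25 1 (.const 4 1) .skip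

/-- Scanning tails of arcs instead of all vertices leaves out the isolated ones, which carry no
condition. -/
theorem GraphState.findUnmarked (h : GraphState n M src dst A s) (hw : 5 * (n * n) + 10 ≤ 2 ^ w) :
    Raises w 10 4 .findUnmarked (M * 10 + 2)
      (∃ p < M, s.mem (4 * (n * n) + 1 + src p) < 1) s := by
  have hM := h.arcs_le
  have hnn : n ≤ n * n := Nat.le_mul_self n
  refine (Raises.forLt (c := 4 + (1 + (1 + (1 + 1)))) (by omega) (by omega)
    (by omega) (by omega) (by omega) (by omega) h.arcs h.one ?_).mono le_rfl (by omega) Iff.rfl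
  intro p hp s1 hF1 hp1
  have g1 := h.frame hF1 (by omega) (by omega)
  refine Raises.seq ((g1.loadArc (K := 11) (f := 4) hw hp1 hp (by omega) (by omega) (by omega)
    (by omega) (by omega) (by omega)).mono le_rfl ?_)
  rintro s2 ⟨hF2, hf2, hs2, hd2⟩
  have g2 := g1.frame hF2 (by omega) (by omega)
  have hsp := h.src_lt p hp
  refine ⟨hF2, hf2, Raises.seq (.add (by rw [g2.goodBase]; omega) ⟨⟨rfl, fun r hr _ => ?_⟩, ?_,
    Raises.seq (.load ⟨⟨rfl, fun r hr _ => ?_⟩, ?_, ?_⟩)⟩)⟩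
  · simp [show r ≠ 25 by omega]
  · simp
  · simp [show r ≠ 25 by omega]
  · simp
  · simp only [State.setReg_reg, if_true, State.setReg_mem, g2.goodBase, hs2]
    have hm : s2.mem = s.mem := hF2.1.trans hF1.1
    have h1 := g2.one
    refine Raises.ifLt (fun hlt => Raises.set (by omega) ?_) fun hlt => Raises.skip le_rfl fun hlt' => ?_
    · simpa [hm, h1] using hlt
    · rw [← hm] at hlt'
      exact hlt (by simpa [h1] using hlt')

end Graph

end WordRAM

/-! ### Reading the input into matrix and arc list. -/

namespace WordRAM

/-- While the input is being read, the memory holds the input, and the adjacency matrix and the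
list of the arcs read so far, which are those in `E`. -/
structure ArcMem (n : ℕ) (input : List ℕ) (E : List (ℕ × ℕ)) (mem : ℕ → ℕ) : Prop where
  input_mem : ∀ i < n * n + 1, mem i = input.getD i 0
  adj_mem : ∀ u < n, ∀ v < n, mem (n * n + 1 + (u * n + v)) = if (u, v) ∈ E then 1 else 0
  src_mem : ∀ k < E.length, mem (2 * (n * n) + 1 + k) = (E.getD k (0, 0)).1
  dst_mem : ∀ k < E.length, mem (3 * (n * n) + 1 + k) = (E.getD k (0, 0)).2
  good_mem : ∀ i, mem (4 * (n * n) + 1 + i) = 0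

theorem mul_add_injective {n u v u' v' : ℕ} (hv : v < n) (hv' : v' < n)
    (h : u * n + v = u' * n + v') : u = u' ∧ v = v' := by
  have h1 : u = u' := by
    have := congrArg (· / n) h
    simpa [Nat.mul_comm _ n, Nat.mul_add_div (by omega : 0 < n), Nat.div_eq_of_lt hv,
      Nat.div_eq_of_lt hv'] using this
  subst h1
  exact ⟨rfl, by omega⟩

/-- Cells behind the input hold 0, which already encodes an empty matrix and no marks. -/
theorem ArcMem.nil {n : ℕ} {input : List ℕ} (h : input.length ≤ n * n + 1) :
    ArcMem n input [] fun i => input.getD i 0 where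
  input_mem _ _ := rfl
  adj_mem u _ v _ := by
    rw [List.getD_eq_default _ _ (by omega)]
    simp
  src_mem := by simp
  dst_mem := by simp
  good_mem i := List.getD_eq_default _ _ (by omega)

theorem ArcMem.append {n : ℕ} {input : List ℕ} {E : List (ℕ × ℕ)} {mem : ℕ → ℕ} {u v : ℕ}
    (h : ArcMem n input E mem) (hE : E.length < n * n) (hu : u < n) (hv : v < n) :
    ArcMem n input (E ++ [(u, v)])
      (Function.update (Function.update (Function.update mem (n * n + 1 + (u * n + v)) 1)
        (2 * (n * n) + 1 + E.length) u) (3 * (n * n) + 1 + E.length) v) := by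
  have huv := mul_add_lt_mul hu hv
  constructor
  · intro i hi
    rw [Function.update_of_ne (by omega), Function.update_of_ne (by omega),
      Function.update_of_ne (by omega), h.input_mem i hi]
  · intro x hx y hy
    have hxy := mul_add_lt_mul hx hy
    rw [Function.update_of_ne (by omega), Function.update_of_ne (by omega)]
    by_cases hc : x = u ∧ y = v
    · obtain ⟨rfl, rfl⟩ := hc
      simp
    · have hne : x * n + y ≠ u * n + v := fun he => hc (mul_add_injective hy hv he)
      rw [Function.update_of_ne (by omega), h.adj_mem x hx y hy]
      simp [hc]
  · intro k hk
    rw [List.length_append, List.length_singleton] at hk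
    rw [Function.update_of_ne (by omega)]
    rcases Nat.lt_succ_iff_lt_or_eq.1 hk with hk' | rfl
    · rw [Function.update_of_ne (by omega), Function.update_of_ne (by omega), h.src_mem k hk',
        List.getD_append _ _ _ _ hk']
    · simp
  · intro k hk
    rw [List.length_append, List.length_singleton] at hk
    rcases Nat.lt_succ_iff_lt_or_eq.1 hk with hk' | rfl
    · rw [Function.update_of_ne (by omega), Function.update_of_ne (by omega),
        Function.update_of_ne (by omega), h.dst_mem k hk', List.getD_append _ _ _ _ hk']
    · simp
  · intro i
    rw [Function.update_of_ne (by omega), Function.update_of_ne (by omega),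
      Function.update_of_ne (by omega), h.good_mem i]

/-- The state while the input is being read: the arcs in `E` have been read, and `rest` remains. -/
structure ReadState (n : ℕ) (input : List ℕ) (E : List (ℕ × ℕ)) (rest : List ℕ) (s : State) :
    Prop where
  one : s.reg 1 = 1
  card : s.reg 2 = n
  adjBase : s.reg 3 = n * n + 1
  flag : s.reg 4 = 0
  arcs : s.reg 5 = E.length
  srcBase : s.reg 6 = 2 * (n * n) + 1
  dstBase : s.reg 7 = 3 * (n * n) + 1
  goodBase : s.reg 8 = 4 * (n * n) + 1
  drop : input.drop (s.reg 10) = rest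
  mem : ArcMem n input E s.mem

section Read

variable {w n : ℕ} {input rest : List ℕ} {E : List (ℕ × ℕ)} {s s' : State}

theorem ReadState.congr (h : ReadState n input E rest s) (hm : s'.mem = s.mem)
    (hr : ∀ r < 11, s'.reg r = s.reg r) : ReadState n input E rest s' where
  one := by rw [hr _ (by omega)]; exact h.one
  card := by rw [hr _ (by omega)]; exact h.card
  adjBase := by rw [hr _ (by omega)]; exact h.adjBase
  flag := by rw [hr _ (by omega)]; exact h.flag
  arcs := by rw [hr _ (by omega)]; exact h.arcs
  srcBase := by rw [hr _ (by omega)]; exact h.srcBase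
  dstBase := by rw [hr _ (by omega)]; exact h.dstBase
  goodBase := by rw [hr _ (by omega)]; exact h.goodBase
  drop := by rw [hr _ (by omega)]; exact h.drop
  mem := by rw [hm]; exact h.mem

theorem ReadState.next {u : ℕ} (h : ReadState n input E (u :: rest) s)
    (hlen : input.length ≤ n * n + 1) :
    s.reg 10 < n * n + 1 ∧ s.mem (s.reg 10) = u ∧ input.drop (s.reg 10 + 1) = rest := by
  have hd := h.drop
  have hlt : s.reg 10 < input.length := by
    by_contra hge
    rw [List.drop_eq_nil_of_le (by omega)] at hd
    simp at hd
  rw [List.drop_eq_getElem_cons hlt] at hd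
  obtain ⟨h1, h2⟩ := List.cons.inj hd
  refine ⟨by omega, ?_, h2⟩
  rw [h.mem.input_mem _ (by omega), List.getD_eq_getElem _ _ hlt, h1]

/-- Read the next neighbour of the vertex in register `11`. -/
def Program.readArc : Program :=
  .seq (.load 14 10) <| .seq (.add 10 10 1) <| .seq (.mul 15 11 2) <| .seq (.add 15 15 14) <|
    .seq (.add 15 3 15) <| .seq (.store 15 1) <| .seq (.add 15 6 5) <| .seq (.store 15 11) <|
      .seq (.add 15 7 5) <| .seq (.store 15 14) (.add 5 5 1)

theorem ReadState.readArc {u v : ℕ} (h : ReadState n input E (v :: rest) s)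
    (hw : 5 * (n * n) + 10 ≤ 2 ^ w) (hlen : input.length ≤ n * n + 1) (hE : E.length < n * n)
    (hv : v < n) (hu : u < n) (h11 : s.reg 11 = u) :
    Ensures w .readArc s 11 fun s' => ReadState n input (E ++ [(u, v)]) rest s' ∧
      ∀ r < 14, 11 ≤ r → s'.reg r = s.reg r := by
  obtain ⟨h1, h2, h3⟩ := h.next hlen
  have huv := mul_add_lt_mul hu hv
  have g1 := h.one
  have g2 := h.card
  have g3 := h.adjBase
  have g5 := h.arcs
  have g6 := h.srcBase
  have g7 := h.dstBase
  refine Ensures.mono (c := 1 + (1 + (1 + (1 + (1 + (1 + (1 + (1 + (1 + (1 + 1))))))))))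
    (.seq <| .load <| .seq <| .add ?_ <| .seq <| .mul ?_ <| .seq <| .add ?_ <| .seq <| .add ?_ <|
      .seq <| .store <| .seq <| .add ?_ <| .seq <| .store <| .seq <| .add ?_ <| .seq <| .store <|
      .add ?_ ?_) le_rfl fun _ h => h
  all_goals simp [g1, g2, g3, g5, g6, g7, h2, h11]
  · omega
  · omega
  · omega
  · omega
  · omega
  · omega
  · omega
  · refine ⟨?_, ?_⟩
    · constructor
      case mem => simpa [g1] using h.mem.append hE hu hv
      all_goals simp [g1, g2, g3, g6, g7, h3, h.flag, h.goodBase]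
    · intro r hr hr'
      simp [show r ≠ 5 by omega, show r ≠ 15 by omega, show r ≠ 10 by omega, show r ≠ 14 by omega]

/-- Read the adjacency list of the vertex in register `11`. -/
def Program.readList : Program :=
  .seq (.load 12 10) <| .seq (.add 10 10 1) <| .forLt 13 12 .readArc

theorem ReadState.readList {u : ℕ} {l : List ℕ}
    (h : ReadState n input E (l.length :: (l ++ rest)) s)
    (hw : 5 * (n * n) + 10 ≤ 2 ^ w) (hlen : input.length ≤ n * n + 1)
    (hE : E.length + l.length ≤ n * n) (hl : ∀ v ∈ l, v < n) (hu : u < n) (h11 : s.reg 11 = u) :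
    Ensures w .readList s (2 + (l.length * 13 + 2)) fun s' =>
      ReadState n input (E ++ l.map (Prod.mk u)) rest s' ∧ s'.reg 11 = u := by
  obtain ⟨h1, h2, h3⟩ := h.next hlen
  have g1 := h.one
  refine Ensures.mono (c := 1 + (1 + (l.length * (11 + 2) + 2))) (.seq <| .load <| .seq <|
    .add ?_ <| (Ensures.forLt (k := l.length) (I := fun j s' => s'.reg 13 = j ∧
      s'.reg 12 = l.length ∧ s'.reg 11 = u ∧
      ReadState n input (E ++ (l.take j).map (Prod.mk u)) (l.drop j ++ rest) s') ?_ ?_ ?_ ?_).mono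
      le_rfl ?_) (by omega) fun _ h => h
  · simp [g1]
    omega
  · omega
  · refine ⟨by simp, by simp [h2], by simp [h11], ?_⟩
    constructor
    case mem => simpa using h.mem
    all_goals simp [g1, h.card, h.adjBase, h.flag, h.arcs, h.srcBase, h.dstBase, h.goodBase, h3]
  · exact fun j s' hs' => ⟨hs'.1, hs'.2.1⟩
  · rintro j hj s' ⟨h13, h12, h11', hs'⟩
    rw [List.drop_eq_getElem_cons hj, List.cons_append] at hs'
    refine (hs'.readArc hw hlen ?_ (hl _ (List.getElem_mem hj)) hu h11').mono le_rfl ?_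
    · simp
      omega
    · rintro s'' ⟨hs'', hr⟩
      refine ⟨(hr 13 (by omega) (by omega)).trans h13, hs''.one, by simp,
        by simpa using (hr 12 (by omega) (by omega)).trans h12,
        by simpa using (hr 11 (by omega) (by omega)).trans h11', ?_⟩
      have : (E ++ (l.take j).map (Prod.mk u)) ++ [(u, l[j])] =
          E ++ (l.take (j + 1)).map (Prod.mk u) := by
        rw [List.take_add_one, List.getElem?_eq_getElem hj, List.map_append, List.append_assoc]
        rfl
      rw [this] at hs''
      exact hs''.congr rfl fun r hr => by simp [show r ≠ 13 by omega]
  · rintro s' ⟨-, -, h11', hs'⟩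
    refine ⟨?_, h11'⟩
    simpa using hs'

/-- Read the input, after the number of vertices. -/
def Program.readLists : Program := .forLt 11 2 .readList

/-- The arcs of the first `j` adjacency lists. -/
def arcsUpTo (f : ℕ → List ℕ) (j : ℕ) : List (ℕ × ℕ) :=
  (List.range j).flatMap fun u => (f u).map (Prod.mk u)

theorem arcsUpTo_succ (f : ℕ → List ℕ) (j : ℕ) :
    arcsUpTo f (j + 1) = arcsUpTo f j ++ (f j).map (Prod.mk j) := by
  simp [arcsUpTo, List.range_succ]

theorem length_arcsUpTo_le {f : ℕ → List ℕ} {j m : ℕ} (h : ∀ u < j, (f u).length ≤ m) :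
    (arcsUpTo f j).length ≤ j * m := by
  induction j with
  | zero => simp [arcsUpTo]
  | succ j ih =>
    have h1 := ih fun u hu => h u (by omega)
    have h2 := h j (by omega)
    rw [arcsUpTo_succ, List.length_append, List.length_map, Nat.succ_mul]
    omega

theorem ReadState.readLists {f : ℕ → List ℕ}
    (h : ReadState n input [] ((List.range' 0 n).flatMap fun u => (f u).length :: f u) s)
    (hw : 5 * (n * n) + 10 ≤ 2 ^ w) (hn : n < 2 ^ w) (hlen : input.length ≤ n * n + 1)
    (hf : ∀ u < n, (f u).length ≤ n) (hf' : ∀ u < n, ∀ v ∈ f u, v < n) :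
    Ensures w .readLists s (n * (n * 13 + 6) + 2) (ReadState n input (arcsUpTo f n) []) := by
  refine (Ensures.forLt (c := 2 + (n * 13 + 2)) (k := n) (I := fun j s' => s'.reg 11 = j ∧
    ReadState n input (arcsUpTo f j)
      ((List.range' j (n - j)).flatMap fun u => (f u).length :: f u) s') hn ?_ ?_ ?_).mono
    (by ring_nf; omega) ?_
  · exact ⟨by simp, h.congr rfl fun r hr => by simp [hr.ne]⟩
  · exact fun j s' hs' => ⟨hs'.1, hs'.2.card⟩
  · rintro j hj s' ⟨h11, hs'⟩
    -- The unread input is indexed by `List.range'` so that the next list splits off at its head.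
    rw [show n - j = (n - (j + 1)) + 1 by omega, List.range'_succ, List.flatMap_cons,
      List.cons_append] at hs'
    have h1 := length_arcsUpTo_le (f := f) (j := j) (m := n) fun u hu => hf u (by omega)
    have h2 : (j + 1) * n ≤ n * n := Nat.mul_le_mul_right n hj
    have h3 := hf j hj
    rw [Nat.succ_mul] at h2
    refine (hs'.readList hw hlen (by omega) (hf' j hj) hj h11).mono (by omega) ?_
    rintro s'' ⟨hs'', h11'⟩
    refine ⟨h11', hs''.one, by simp, ?_⟩
    rw [arcsUpTo_succ]
    exact hs''.congr rfl fun r hr => by simp [hr.ne]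
  · rintro s' ⟨-, hs'⟩
    simpa using hs'

/-- Initialize the registers. -/
def Program.setUp : Program :=
  .seq (.const 1 1) <| .seq (.load 2 0) <| .seq (.mul 9 2 2) <| .seq (.add 3 9 1) <|
    .seq (.add 6 3 9) <| .seq (.add 7 6 9) <| .seq (.add 8 7 9) (.const 10 1)

theorem ensures_setUp (hw : 5 * (n * n) + 10 ≤ 2 ^ w) (hlen : rest.length ≤ n * n) :
    Ensures w .setUp (init (n :: rest)) 8 (ReadState n (n :: rest) [] rest) := by
  have hw1 : w ≠ 0 := by
    rintro rfl
    omega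
  -- Register 0 still holds 0, the address of n; reading continues at cell 1.
  refine Ensures.mono (c := 1 + (1 + (1 + (1 + (1 + (1 + (1 + 1)))))))
    (.seq <| .const ?_ <| .seq <| .load <| .seq <| .mul ?_ <| .seq <| .add ?_ <| .seq <| .add ?_ <|
      .seq <| .add ?_ <| .seq <| .add ?_ <| .const ?_ ?_) le_rfl fun _ h => h
  all_goals simp [init]
  · exact hw1
  · omega
  · omega
  · omega
  · omega
  · omega
  · exact hw1
  · constructor
    case mem =>
      have := ArcMem.nil (n := n) (input := n :: rest) (by simpa using hlen)
      simpa using this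
    all_goals simp
    all_goals omega

theorem ReadState.graphState (h : ReadState n input E rest s) (hE : E.length ≤ n * n)
    (hE' : ∀ e ∈ E, e.1 < n ∧ e.2 < n) :
    GraphState n E.length (fun k => (E.getD k (0, 0)).1) (fun k => (E.getD k (0, 0)).2)
      (fun u v => (u, v) ∈ E) s where
  one := h.one
  card := h.card
  adjBase := h.adjBase
  arcs := h.arcs
  srcBase := h.srcBase
  dstBase := h.dstBase
  goodBase := h.goodBase
  arcs_le := hE
  src_lt k hk := by
    rw [List.getD_eq_getElem _ _ hk]
    exact (hE' _ (List.getElem_mem hk)).1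
  dst_lt k hk := by
    rw [List.getD_eq_getElem _ _ hk]
    exact (hE' _ (List.getElem_mem hk)).2
  src_mem := h.mem.src_mem
  dst_mem := h.mem.dst_mem
  adj_mem u hu v hv := by
    rw [h.mem.adj_mem u hu v hv]
    split_ifs with hc <;> simp [hc]

end Read

/-! ### The whole program. -/

/-- Decide whether the input is a triangle-free clique dually conformal graph. -/
def Program.triangleFreeCDC : Program :=
  .seq .setUp <| .seq .readLists <| .seq .findTriangle <| .seq .markGood <| .seq .findUnmarked <|
    .sub 0 1 4

/-- The adjacency relation `R` has a triangle, or some vertex has neighbours but none whose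
neighbourhood is contained in the neighbourhoods of all the others. -/
def Violates (R : ℕ → ℕ → Prop) : Prop :=
  (∃ u v a, R u v ∧ R u a ∧ R v a) ∨
    ∃ u v, R u v ∧ ∀ x, R u x → ∃ b a, R x b ∧ R u a ∧ ¬ R b a

theorem exists_lt_length_getD_iff {E : List (ℕ × ℕ)} {p : ℕ × ℕ → Prop} :
    (∃ k < E.length, p (E.getD k (0, 0))) ↔ ∃ e ∈ E, p e := by
  constructor
  · rintro ⟨k, hk, h⟩
    rw [List.getD_eq_getElem _ _ hk] at h
    exact ⟨_, List.getElem_mem hk, h⟩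
  · rintro ⟨e, he, h⟩
    obtain ⟨k, hk, rfl⟩ := List.mem_iff_getElem.1 he
    exact ⟨k, hk, by rwa [List.getD_eq_getElem _ _ hk]⟩

/-- Quantifying over arc numbers amounts to quantifying over members of E, and the bound a < n is
automatic for ends of arcs. -/
theorem violates_iff {n : ℕ} {E : List (ℕ × ℕ)} {src dst : ℕ → ℕ}
    (hsrc : src = fun k => (E.getD k (0, 0)).1) (hdst : dst = fun k => (E.getD k (0, 0)).2)
    (hE : ∀ e ∈ E, e.1 < n ∧ e.2 < n) :
    Violates (fun u v => (u, v) ∈ E) ↔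
      (∃ p < E.length, ∃ a < n, (src p, a) ∈ E ∧ (dst p, a) ∈ E) ∨
      ∃ p < E.length, ¬ ∃ p' < E.length, src p' = src p ∧
        ¬ BadArc n E.length src dst (fun u v => (u, v) ∈ E) p' := by
  subst hsrc hdst
  have hbad : ∀ p, BadArc n E.length (fun k => (E.getD k (0, 0)).1) (fun k => (E.getD k (0, 0)).2)
      (fun u v => (u, v) ∈ E) p ↔ ∃ b a, ((E.getD p (0, 0)).2, b) ∈ E ∧
        ((E.getD p (0, 0)).1, a) ∈ E ∧ (b, a) ∉ E := by
    intro p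
    refine (exists_lt_length_getD_iff (E := E) (p := fun e => e.1 = (E.getD p (0, 0)).2 ∧
      ∃ a < n, ((E.getD p (0, 0)).1, a) ∈ E ∧ (e.2, a) ∉ E)).trans ?_
    constructor
    · rintro ⟨⟨x, b⟩, he, rfl, a, -, h⟩
      exact ⟨b, a, he, h⟩
    · rintro ⟨b, a, he, h⟩
      exact ⟨_, he, rfl, a, (hE _ h.1).2, h⟩
  refine or_congr ?_ ?_
  · rw [exists_lt_length_getD_iff (E := E) (p := fun e => ∃ a < n, (e.1, a) ∈ E ∧ (e.2, a) ∈ E)]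
    constructor
    · rintro ⟨u, v, a, huv, h⟩
      exact ⟨_, huv, a, (hE _ h.1).2, h⟩
    · rintro ⟨⟨u, v⟩, huv, a, -, h⟩
      exact ⟨u, v, a, huv, h⟩
  · simp only [hbad]
    have key : ∀ u, (∃ p' < E.length, (E.getD p' (0, 0)).1 = u ∧
        ¬ ∃ b a, ((E.getD p' (0, 0)).2, b) ∈ E ∧ ((E.getD p' (0, 0)).1, a) ∈ E ∧ (b, a) ∉ E) ↔
        ∃ x, (u, x) ∈ E ∧ ¬ ∃ b a, (x, b) ∈ E ∧ (u, a) ∈ E ∧ (b, a) ∉ E := by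
      intro u
      refine (exists_lt_length_getD_iff (E := E) (p := fun e => e.1 = u ∧
        ¬ ∃ b a, (e.2, b) ∈ E ∧ (e.1, a) ∈ E ∧ (b, a) ∉ E)).trans ?_
      constructor
      · rintro ⟨⟨u, x⟩, he, rfl, h⟩
        exact ⟨x, he, h⟩
      · rintro ⟨x, he, h⟩
        exact ⟨_, he, rfl, h⟩
    simp only [key]
    rw [exists_lt_length_getD_iff (E := E) (p := fun e => ¬ ∃ x, (e.1, x) ∈ E ∧
      ¬ ∃ b a, (x, b) ∈ E ∧ (e.1, a) ∈ E ∧ (b, a) ∉ E)]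
    simp only [not_exists, not_and, not_not, Prod.exists]
    push Not
    rfl

theorem mem_arcsUpTo {f : ℕ → List ℕ} {j u v : ℕ} :
    (u, v) ∈ arcsUpTo f j ↔ u < j ∧ v ∈ f u := by
  simp only [arcsUpTo, List.mem_flatMap, List.mem_range, List.mem_map, Prod.mk.injEq]
  constructor
  · rintro ⟨u, hu, v, hv, rfl, rfl⟩
    exact ⟨hu, hv⟩
  · rintro ⟨hu, hv⟩
    exact ⟨u, hu, v, hv, rfl, rfl⟩

theorem length_flatMap_cons_length (f : ℕ → List ℕ) (n : ℕ) :
    ((List.range' 0 n).flatMap fun u => (f u).length :: f u).length =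
      n + (arcsUpTo f n).length := by
  rw [← List.range_eq_range']
  induction n with
  | zero => rfl
  | succ n ih =>
    rw [arcsUpTo_succ, List.range_succ, List.flatMap_append, List.length_append, ih]
    simp
    omega

theorem ensures_triangleFreeCDC {w n : ℕ} {f : ℕ → List ℕ} (hw : 5 * (n * n) + 10 ≤ 2 ^ w)
    (hn : n < 2 ^ w) (hf : ∀ u < n, (f u).length < n) (hf' : ∀ u < n, ∀ v ∈ f u, v < n) :
    Ensures w .triangleFreeCDC
      (init (n :: (List.range' 0 n).flatMap fun u => (f u).length :: f u))
      (8 + ((n * (n * 13 + 6) + 2) + (((arcsUpTo f n).length * (n * 13 + 8) + 2) +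
        (((arcsUpTo f n).length * ((arcsUpTo f n).length * (n * 13 + 10) + 12) + 2) +
          (((arcsUpTo f n).length * 10 + 2) + 1)))))
      fun s =>
        (Violates (fun u v => (u, v) ∈ arcsUpTo f n) → s.reg 0 = 0) ∧
        (¬ Violates (fun u v => (u, v) ∈ arcsUpTo f n) → s.reg 0 = 1) := by
  -- Each list has at most n - 1 entries; this makes the input fit in front of the matrix.
  have hlenE : (arcsUpTo f n).length + n ≤ n * n := by
    obtain _ | m := n
    · simp [arcsUpTo]
    · have := length_arcsUpTo_le (f := f) (j := m + 1) (m := m)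
        fun u hu => Nat.lt_succ_iff.1 (hf u hu)
      rw [Nat.mul_succ (m + 1) m]
      omega
  have hE : ∀ e ∈ arcsUpTo f n, e.1 < n ∧ e.2 < n := by
    rintro ⟨u, v⟩ he
    obtain ⟨hu, hv⟩ := mem_arcsUpTo.1 he
    exact ⟨hu, hf' u hu v hv⟩
  have hlen : ((List.range' 0 n).flatMap fun u => (f u).length :: f u).length ≤ n * n := by
    rw [length_flatMap_cons_length]
    omega
  refine .seq ((ensures_setUp hw hlen).mono le_rfl fun s1 h1 => .seq ?_)
  refine (h1.readLists hw hn (by simpa using hlen) (fun u hu => (hf u hu).le) hf').mono le_rfl ?_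
  intro s2 h2
  have g2 := h2.graphState (by omega) hE
  have hgood := h2.mem.good_mem
  have hflag := h2.flag
  generalize arcsUpTo f n = E at *
  generalize hsrc : (fun k => (E.getD k (0, 0)).1) = src at g2
  generalize hdst : (fun k => (E.getD k (0, 0)).2) = dst at g2
  have hviol := violates_iff hsrc.symm hdst.symm hE
  refine .seq (Ensures.mono (g2.findTriangle hw hn) le_rfl ?_)
  rintro s3 ⟨hF3, ht3, ht3'⟩
  have g3 := g2.frame hF3 (by omega) (by omega)
  refine .seq ((g3.markGood hw hn fun u _ => by rw [hF3.1]; exact hgood u).mono le_rfl ?_)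
  rintro s4 ⟨g4, h44, hm4⟩
  refine .seq (Ensures.mono (g4.findUnmarked hw) le_rfl ?_)
  rintro s5 ⟨hF5, ht5, ht5'⟩
  have g5 := g4.frame hF5 (by omega) (by omega)
  have h5 : (∃ p < E.length, s4.mem (4 * (n * n) + 1 + src p) < 1) ↔
      ∃ p < E.length, ¬ ∃ p' < E.length, src p' = src p ∧
        ¬ BadArc n E.length src dst (fun u v => (u, v) ∈ E) p' :=
    exists_congr fun p => and_congr_right fun hp => hm4 _ (g4.src_lt p hp)
  rw [h5] at ht5 ht5'
  -- The answer is 1 minus the flag.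
  refine .sub ?_
  simp only [State.setReg_reg, if_true, g5.one]
  rw [hviol]
  refine ⟨fun hv => ?_, fun hv => ?_⟩
  · rw [or_iff_not_imp_right] at hv
    by_cases hv2 : ∃ p < E.length, ¬ ∃ p' < E.length, src p' = src p ∧
        ¬ BadArc n E.length src dst (fun u v => (u, v) ∈ E) p'
    · rw [ht5 hv2]
    · rw [ht5' hv2, h44, ht3 (hv hv2)]
  · rw [not_or] at hv
    rw [ht5' hv.2, h44, ht3' hv.1, hflag]

end WordRAM

/-! ### From adjacency lists to the theorem. -/

namespace SimpleGraph

variable {n : ℕ} {G : SimpleGraph (Fin n)} {L : Fin n → List (Fin n)}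

/-- The adjacency lists of a graph on `Fin n`, as lists of numbers indexed by numbers. -/
def natAdjacencyLists (L : Fin n → List (Fin n)) (u : ℕ) : List ℕ :=
  if h : u < n then (L ⟨u, h⟩).map Fin.val else []

theorem encodeAdjacencyLists_eq (L : Fin n → List (Fin n)) :
    encodeAdjacencyLists L = n :: (List.range' 0 n).flatMap fun u =>
      (natAdjacencyLists L u).length :: natAdjacencyLists L u := by
  rw [encodeAdjacencyLists, ← List.range_eq_range', ← List.map_coe_finRange_eq_range,
    List.flatMap_map]
  congr 2
  funext v
  simp [natAdjacencyLists]

theorem IsAdjacencyLists.mem_arcsUpTo (hL : G.IsAdjacencyLists L) {u v : ℕ} :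
    (u, v) ∈ WordRAM.arcsUpTo (natAdjacencyLists L) n ↔
      ∃ (hu : u < n) (hv : v < n), G.Adj ⟨u, hu⟩ ⟨v, hv⟩ := by
  rw [WordRAM.mem_arcsUpTo]
  constructor
  · rintro ⟨hu, hv⟩
    simp only [natAdjacencyLists, hu, dif_pos, List.mem_map] at hv
    obtain ⟨x, hx, rfl⟩ := hv
    exact ⟨hu, x.2, ((hL _).2 _).1 hx⟩
  · rintro ⟨hu, hv, h⟩
    simp only [natAdjacencyLists, hu, dif_pos, List.mem_map, true_and]
    exact ⟨_, ((hL _).2 _).2 h, rfl⟩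

theorem IsAdjacencyLists.length_eq_degree [DecidableRel G.Adj] (hL : G.IsAdjacencyLists L)
    (v : Fin n) : (L v).length = G.degree v := by
  rw [← List.toFinset_card_of_nodup (hL v).1, ← card_neighborFinset_eq_degree]
  congr 1
  ext u
  simp [(hL v).2 u]

/-- The handshake lemma. -/
theorem IsAdjacencyLists.length_arcsUpTo (hL : G.IsAdjacencyLists L) :
    (WordRAM.arcsUpTo (natAdjacencyLists L) n).length = 2 * G.edgeSet.ncard := by
  classical
  have h1 : ∀ j, (WordRAM.arcsUpTo (natAdjacencyLists L) j).length =
      ∑ u ∈ Finset.range j, (natAdjacencyLists L u).length := by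
    intro j
    induction j with
    | zero => rfl
    | succ j ih => rw [WordRAM.arcsUpTo_succ, Finset.sum_range_succ, ← ih]; simp
  rw [h1, Finset.sum_range, ← coe_edgeFinset, Set.ncard_coe_finset,
    ← sum_degrees_eq_twice_card_edges]
  refine Finset.sum_congr rfl fun v _ => ?_
  simp [natAdjacencyLists, hL.length_eq_degree]

theorem IsAdjacencyLists.not_violates_iff [NeZero n] (hL : G.IsAdjacencyLists L) :
    ¬ WordRAM.Violates (fun u v => (u, v) ∈ WordRAM.arcsUpTo (natAdjacencyLists L) n) ↔
      G.CliqueFree 3 ∧ G.IsCDC := by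
  have h : G.CliqueFree 3 ∧ G.IsCDC ↔ G.CliqueFree 3 ∧ ∀ w y, G.Adj w y →
      ∃ x, G.Adj w x ∧ ∀ a, G.Adj w a → ∀ b, G.Adj x b → G.Adj b a :=
    and_congr_right fun hG => hG.isCDC_iff
  rw [h, WordRAM.Violates, not_or, cliqueFree_three_iff]
  simp only [hL.mem_arcsUpTo]
  refine and_congr ?_ ?_
  · constructor
    · exact fun h u v x huv hux hvx => h ⟨u, v, x, ⟨u.2, v.2, huv⟩, ⟨u.2, x.2, hux⟩, ⟨v.2, x.2, hvx⟩⟩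
    · rintro h ⟨u, v, x, ⟨hu, hv, huv⟩, ⟨_, hx, hux⟩, ⟨_, _, hvx⟩⟩
      exact h _ _ _ huv hux hvx
  · constructor
    · intro h w y hwy
      by_contra! hno
      refine h ⟨w, y, ⟨w.2, y.2, hwy⟩, ?_⟩
      rintro x ⟨hw, hx, hwx⟩
      obtain ⟨a, hwa, b, hxb, hba⟩ := hno _ hwx
      exact ⟨b, a, ⟨_, b.2, hxb⟩, ⟨_, a.2, hwa⟩, fun ⟨_, _, h⟩ => hba h⟩
    · rintro h ⟨w, y, ⟨hw, hy, hwy⟩, hno⟩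
      obtain ⟨x, hwx, hx⟩ := h _ _ hwy
      obtain ⟨b, a, ⟨_, hb, hxb⟩, ⟨_, ha, hwa⟩, hba⟩ := hno x ⟨hw, x.2, hwx⟩
      exact hba ⟨hb, ha, hx _ hwa _ hxb⟩

end SimpleGraph

theorem mainTheorem7 :
    ∃ (P : WordRAM.Program) (d C : ℕ),
      ∀ (n : ℕ), 1 ≤ n →
        ∀ (G : SimpleGraph (Fin n)) (L : Fin n → List (Fin n)), G.IsAdjacencyLists L →
          ∀ w : ℕ, (n + 2) ^ d ≤ 2 ^ w →
            WordRAM.DecidesWithin w P (SimpleGraph.encodeAdjacencyLists L)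
              (G.CliqueFree 3 ∧ G.IsCDC) (C * (n * (n + G.edgeSet.ncard) ^ 2)) := by
  classical
  -- Exponent 5 suffices because (n + 2)³ ≥ 27 and 27(n + 2)² ≥ 5n² + 10.
  refine ⟨.triangleFreeCDC, 5, 300, fun n hn G L hL w hw => ?_⟩
  have : NeZero n := ⟨by omega⟩
  have hw' : 5 * (n * n) + 10 ≤ 2 ^ w := by
    refine le_trans ?_ hw
    nlinarith [Nat.pow_le_pow_left (show 3 ≤ n + 2 by omega) 3, sq_nonneg n]
  have hn' : n < 2 ^ w := by nlinarith
  have hlen : ∀ u < n, (SimpleGraph.natAdjacencyLists L u).length < n := by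
    intro u hu
    simpa [SimpleGraph.natAdjacencyLists, hu, hL.length_eq_degree] using
      G.degree_lt_card_verts ⟨u, hu⟩
  have hmem : ∀ u < n, ∀ v ∈ SimpleGraph.natAdjacencyLists L u, v < n := by
    intro u hu v hv
    simp only [SimpleGraph.natAdjacencyLists, hu, dif_pos, List.mem_map] at hv
    obtain ⟨x, -, rfl⟩ := hv
    exact x.2
  obtain ⟨t, s, he, ht, h0, h1⟩ := WordRAM.ensures_triangleFreeCDC hw' hn' hlen hmem
  rw [SimpleGraph.encodeAdjacencyLists_eq]
  refine ⟨t, s, he, ht.trans ?_, fun h => h1 (hL.not_violates_iff.2 h), fun h => h0 ?_⟩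
  · rw [hL.length_arcsUpTo]
    generalize G.edgeSet.ncard = m
    -- The cost is 52nm² + 40m² + 26nm + 60m + 13n² + 6n + 17. As n ≥ 1, each term is at most a
    -- multiple of nm², n²m or n³; the constant 300 is generous.
    have e1 : 1 ≤ n * n := Nat.mul_pos hn hn
    have e2 : n * n ≤ n * n * n := Nat.le_mul_of_pos_right _ hn
    have e3 : m ≤ n * n * m := Nat.le_mul_of_pos_left _ e1
    have e4 : n * m ≤ n * n * m := Nat.mul_le_mul_right m (Nat.le_mul_self n)
    have e5 : m * m ≤ n * m * m := by
      rw [Nat.mul_assoc]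
      exact Nat.le_mul_of_pos_left _ hn
    have e6 : n ≤ n * n := Nat.le_mul_self n
    ring_nf at *
    omega
  · by_contra hv
    exact h (hL.not_violates_iff.1 hv)
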